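/- Let $X$ be a real Banach space with the property $\mathrm{IP}_{f,\infty}$: every family of closed balls of $X$ with empty intersection contains a finite subfamily with empty intersection. Then the following are equivalent: (1) $X$ has the Mazur Intersection Property (MIP): every nonempty closed bounded convex set $K \subseteq X$ is the intersection of the closed balls containing it; (2) every nonempty closed bounded convex set $K \subseteq X$ is the closed convex hull of its farthest points, where $z \in K$ is a farthest point of $K$ if there is $x \in X$ with $\|z-x\| = r_K(x) := \sup\{\|w-x\| : w \in K\}$. Closed balls have positive radius. -/

import Mathlib

section

variable {X : Type*} [NormedAddCommGroup X]

/-- `B` is a closed ball of `X` (of positive radius). -/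
def IsClosedBall (B : Set X) : Prop :=
  ∃ (x : X) (r : ℝ), 0 < r ∧ B = Metric.closedBall x r

/-- A set is admissible if it is the intersection of the closed balls containing it. -/
def IsAdmissible (K : Set X) : Prop :=
  K = ⋂₀ {B : Set X | IsClosedBall B ∧ K ⊆ B}

/-- The farthest distance map `r_K(x) = sup {‖z - x‖ : z ∈ K}` of a (bounded) set `K`. -/
noncomputable def farthestDist (K : Set X) (x : X) : ℝ :=
  sSup ((fun z : X => ‖z - x‖) '' K)

/-- `Q_K(x)`, the set of points of `K` farthest from `x`. -/
def farthestFrom (K : Set X) (x : X) : Set X :=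
  {z ∈ K | ‖z - x‖ = farthestDist K x}

/-- `b(K)`, the set of farthest points of `K`. -/
def farthestPoints (K : Set X) : Set X :=
  ⋃ x : X, farthestFrom K x

end

/-- The property IP_{f,∞}: every family of closed balls with empty intersection contains a
finite subfamily with empty intersection. -/
def HasIPFinInf (X : Type*) [NormedAddCommGroup X] : Prop :=
  ∀ 𝓑 : Set (Set X), (∀ B ∈ 𝓑, IsClosedBall B) → ⋂₀ 𝓑 = ∅ →
    ∃ 𝓕 : Set (Set X), 𝓕 ⊆ 𝓑 ∧ 𝓕.Finite ∧ ⋂₀ 𝓕 = ∅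

/-- The Mazur Intersection Property: every nonempty closed bounded convex set is the
intersection of the closed balls containing it. (Nonemptiness matters only for the zero space,
where the empty set is not an intersection of balls.) -/
def HasMIP (X : Type*) [NormedAddCommGroup X] [NormedSpace ℝ X] : Prop :=
  ∀ K : Set X, K.Nonempty → IsClosed K → Bornology.IsBounded K → Convex ℝ K → IsAdmissible K

/-!
The two implications use different ideas.

*Farthest points give the Mazur intersection property.* Separate `x₀ ∉ K` from a small enlargement
`K + closedBall 0 ε` by a functional, and let `D` be the closed convex hull of that enlargement
together with `x₀`. Since `D` is generated by its farthest points, one of them, farthest from `x`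
say, lies on the side of `x₀`. On that side the distance to `x` is controlled by `‖x₀ - x‖`, so
`x₀` itself is farthest from `x`. The enlargement then sits in the closed ball around `x` of radius
`‖x₀ - x‖`, hence `K` sits in a slightly smaller ball, which misses `x₀`. This direction is
`hasMIP_of_eq_closedConvexHull_farthestPoints`, and needs neither completeness nor the ball
intersection hypothesis.

*The Mazur intersection property gives farthest points.* Together with `HasIPFinInf` it forces
decreasing sequences of nonempty closed bounded convex sets to have a common point
(`HasMIP.nonempty_iInter_of_antitone`), a form of reflexivity. Under this intersection property the
points `x` having a farthest point in `K` are dense (`dense_setOf_farthestFrom_nonempty`):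
by Baire, for a dense set of `x` the farthest distance map `r` of `K` increases towards `x` at
almost unit rate along directions `y - k`, with `y` close to `x` and `k ∈ K`. A subgradient `f` of
`r` at `x` then satisfies `sup f (x - K) = r x`, and a point of `K` where this supremum is attained
is farthest from `x`. Finally, if some `x₀ ∈ K` were outside the closed convex hull `L` of the
farthest points, a ball around some `y` would contain `L` but not `x₀`; moving `y` slightly to
a point that has a farthest point in `K` produces a farthest point outside that ball.
-/

open Set Metric
open scoped Pointwise

/-! ### The farthest distance map -/

section FarthestDist

variable {X : Type*} [NormedAddCommGroup X] {K : Set X}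

theorem bddAbove_norm_sub_image (hK : Bornology.IsBounded K) (x : X) :
    BddAbove ((fun z : X => ‖z - x‖) '' K) := by
  obtain ⟨R, hR⟩ := hK.subset_closedBall x
  refine ⟨R, ?_⟩
  rintro _ ⟨z, hz, rfl⟩
  simpa [dist_eq_norm] using hR hz

theorem norm_sub_le_farthestDist (hK : Bornology.IsBounded K) {z : X} (hz : z ∈ K) (x : X) :
    ‖z - x‖ ≤ farthestDist K x :=
  le_csSup (bddAbove_norm_sub_image hK x) ⟨z, hz, rfl⟩

theorem farthestDist_le (hne : K.Nonempty) {x : X} {c : ℝ} (h : ∀ z ∈ K, ‖z - x‖ ≤ c) :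
    farthestDist K x ≤ c := by
  refine csSup_le (hne.image _) ?_
  rintro _ ⟨z, hz, rfl⟩
  exact h z hz

theorem exists_lt_norm_sub_of_lt_farthestDist (hne : K.Nonempty) {x : X} {c : ℝ}
    (h : c < farthestDist K x) : ∃ z ∈ K, c < ‖z - x‖ := by
  by_contra! hcon
  exact h.not_ge (farthestDist_le hne hcon)

theorem farthestDist_nonneg (hne : K.Nonempty) (hK : Bornology.IsBounded K) (x : X) :
    0 ≤ farthestDist K x :=
  let ⟨_, hz⟩ := hne
  (norm_nonneg _).trans (norm_sub_le_farthestDist hK hz x)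

theorem farthestDist_le_add_norm_sub (hne : K.Nonempty) (hK : Bornology.IsBounded K) (x y : X) :
    farthestDist K x ≤ farthestDist K y + ‖x - y‖ := by
  refine farthestDist_le hne fun z hz => ?_
  have h1 := norm_sub_le_farthestDist hK hz y
  have h2 := norm_sub_le_norm_sub_add_norm_sub z y x
  rw [norm_sub_rev y x] at h2
  linarith

theorem continuous_farthestDist (hne : K.Nonempty) (hK : Bornology.IsBounded K) :
    Continuous (farthestDist K) := by
  refine (LipschitzWith.of_le_add fun x y => ?_).continuous
  rw [dist_eq_norm]
  exact farthestDist_le_add_norm_sub hne hK x y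

theorem convexOn_farthestDist [NormedSpace ℝ X] (hne : K.Nonempty) (hK : Bornology.IsBounded K) :
    ConvexOn ℝ univ (farthestDist K) := by
  refine ⟨convex_univ, fun x _ y _ a b ha hb hab => farthestDist_le hne fun z hz => ?_⟩
  have hz' : z - (a • x + b • y) = a • (z - x) + b • (z - y) := by
    have : z = a • z + b • z := by rw [← add_smul, hab, one_smul]
    nth_rewrite 1 [this]
    module
  rw [hz', smul_eq_mul, smul_eq_mul]
  refine (norm_add_le _ _).trans ?_
  rw [norm_smul, norm_smul, Real.norm_of_nonneg ha, Real.norm_of_nonneg hb]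
  gcongr
  · exact norm_sub_le_farthestDist hK hz x
  · exact norm_sub_le_farthestDist hK hz y

theorem mem_farthestPoints_iff {z : X} :
    z ∈ farthestPoints K ↔ z ∈ K ∧ ∃ x, ‖z - x‖ = farthestDist K x := by
  simp [farthestPoints, farthestFrom]

end FarthestDist

/-! ### Subgradients and balls -/

section Subgradient

variable {X : Type*} [NormedAddCommGroup X] [NormedSpace ℝ X]

/-- A continuous convex function has a continuous subgradient at every point. -/
theorem ConvexOn.exists_subgradient {φ : X → ℝ} (hφ : ConvexOn ℝ univ φ) (hc : Continuous φ)
    (x : X) : ∃ f : StrongDual ℝ X, ∀ y, φ x + f (y - x) ≤ φ y := by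
  have hopen : IsOpen {p : X × ℝ | p.1 ∈ univ ∧ φ p.1 < p.2} := by
    simpa using isOpen_lt (hc.comp continuous_fst) continuous_snd
  obtain ⟨L, hL⟩ := geometric_hahn_banach_point_open hφ.convex_strict_epigraph hopen
    (x := (x, φ x)) (by simp)
  have hsplit : ∀ (y : X) (t : ℝ), L (y, t) = L (y, 0) + t * L (0, 1) := by
    intro y t
    rw [← smul_eq_mul, ← map_smul, ← map_add]
    simp
  set c := L (0, 1) with hcdef
  have hpos : 0 < c := by
    have := hL (x, φ x + 1) (by simp)
    rw [hsplit, hsplit x (φ x + 1)] at this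
    linarith
  refine ⟨-c⁻¹ • L.comp (.inl ℝ X ℝ), fun y => le_of_forall_gt fun t ht => ?_⟩
  have h1 := hL (y, t) (by simpa using ht)
  rw [hsplit, hsplit y t] at h1
  have h2 : L (y - x, 0) = L (y, 0) - L (x, 0) := by rw [← map_sub]; simp
  have h3 : (-c⁻¹ • L.comp (.inl ℝ X ℝ)) (y - x) = -(c⁻¹ * (L (y, 0) - L (x, 0))) := by
    simp [h2]
  rw [h3]
  have h4 : c⁻¹ * (φ x * c - t * c) < c⁻¹ * (L (y, 0) - L (x, 0)) :=
    mul_lt_mul_of_pos_left (by linarith) (inv_pos.2 hpos)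
  have h5 : c⁻¹ * (φ x * c - t * c) = φ x - t := by field_simp
  linarith

/-- In a nontrivial space, a vector `v` can be lengthened by exactly `ε` by adding a vector of
norm at most `ε`. -/
theorem exists_norm_add_eq_add [Nontrivial X] (v : X) {ε : ℝ} (hε : 0 ≤ ε) :
    ∃ e : X, ‖e‖ ≤ ε ∧ ‖v + e‖ = ‖v‖ + ε := by
  by_cases hv : v = 0
  · obtain ⟨e, he⟩ := exists_norm_eq X hε
    exact ⟨e, he.le, by simp [hv, he]⟩
  · have hv' : ‖v‖ ≠ 0 := norm_ne_zero_iff.2 hv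
    refine ⟨(ε / ‖v‖) • v, ?_, ?_⟩
    · rw [norm_smul, Real.norm_of_nonneg (by positivity), div_mul_cancel₀ _ hv']
    · have : v + (ε / ‖v‖) • v = (1 + ε / ‖v‖) • v := by module
      rw [this, norm_smul, Real.norm_of_nonneg (by positivity), add_mul, one_mul,
        div_mul_cancel₀ _ hv']

end Subgradient

/-! ### From farthest points to the Mazur intersection property -/

section ToMIP

variable {X : Type*} [NormedAddCommGroup X] [NormedSpace ℝ X]

/-- If the closed convex hull of `insert x₀ S` is generated by its farthest points and `x₀` is
strictly separated from `S`, then `x₀` is at least as far from some `x` as every point of `S`. -/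
theorem exists_norm_sub_le_of_closedConvexHull_farthestPoints {S : Set X} {x₀ : X}
    (hS : Bornology.IsBounded S) (f : StrongDual ℝ X) {s : ℝ} (hfS : ∀ y ∈ S, f y ≤ s)
    (hfx : s < f x₀)
    (h : closedConvexHull ℝ (insert x₀ S) =
      closedConvexHull ℝ (farthestPoints (closedConvexHull ℝ (insert x₀ S)))) :
    ∃ x, ∀ y ∈ S, ‖y - x‖ ≤ ‖x₀ - x‖ := by
  set D := closedConvexHull ℝ (insert x₀ S) with hD
  have hsub : insert x₀ S ⊆ D := subset_closedConvexHull
  have hDb : Bornology.IsBounded D := by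
    rw [hD, closedConvexHull_eq_closure_convexHull]
    exact (isBounded_convexHull.2 (hS.insert x₀)).closure
  obtain ⟨z, hz, hfz⟩ : ∃ z ∈ farthestPoints D, s < f z := by
    by_contra! hcon
    have : D ⊆ {y | f y ≤ s} := by
      rw [h]
      exact closedConvexHull_min hcon (convex_halfSpace_le f.isLinear s)
        (isClosed_le f.continuous continuous_const)
    exact (this (hsub (mem_insert x₀ S))).not_gt hfx
  obtain ⟨hzD, x, hzx⟩ := mem_farthestPoints_iff.1 hz
  refine ⟨x, fun y hy => (norm_sub_le_farthestDist hDb (hsub (mem_insert_of_mem _ hy)) x).trans ?_⟩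
  by_contra! hlt
  set r := farthestDist D x with hr
  -- `a` is the slope for which `‖y - x‖ + a * (f y - s) ≤ r` holds on `S` and at `x₀`, hence on `D`
  set a := (r - ‖x₀ - x‖) / (f x₀ - s) with ha
  have hfpos : 0 < f x₀ - s := by linarith
  have hapos : 0 < a := div_pos (by linarith) hfpos
  have hDs : D ⊆ {y | ‖y - x‖ + a * (f y - s) ≤ r} := by
    refine closedConvexHull_min ?_ ?_ ?_
    · rintro y (rfl | hy)
      · have : a * (f y - s) = r - ‖y - x‖ := div_mul_cancel₀ _ hfpos.ne'
        simp [this]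
      · have h1 := norm_sub_le_farthestDist hDb (hsub (mem_insert_of_mem _ hy)) x
        have h2 : a * (f y - s) ≤ 0 :=
          mul_nonpos_of_nonneg_of_nonpos hapos.le (by linarith [hfS y hy])
        simp only [mem_ofPred_eq]
        linarith
    · intro y hy w hw p q hp hq hpq
      simp only [mem_ofPred_eq] at hy hw ⊢
      have e1 : p • y + q • w - x = p • (y - x) + q • (w - x) := by
        have : x = p • x + q • x := by rw [← add_smul, hpq, one_smul]
        nth_rewrite 1 [this]
        module
      have e2 : ‖p • y + q • w - x‖ ≤ p * ‖y - x‖ + q * ‖w - x‖ := by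
        rw [e1]
        refine (norm_add_le _ _).trans ?_
        rw [norm_smul, norm_smul, Real.norm_of_nonneg hp, Real.norm_of_nonneg hq]
      have e3 : a * (f (p • y + q • w) - s) = p * (a * (f y - s)) + q * (a * (f w - s)) := by
        simp only [map_add, map_smul, smul_eq_mul]
        linear_combination (a * s) * hpq
      have e4 := mul_le_mul_of_nonneg_left hy hp
      have e5 := mul_le_mul_of_nonneg_left hw hq
      have e6 : p * r + q * r = r := by rw [← add_mul, hpq, one_mul]
      linarith
    · exact isClosed_le (by fun_prop) continuous_const
  have hz2 := hDs hzD
  have := mul_pos hapos (sub_pos.2 hfz)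
  simp only [mem_ofPred_eq] at hz2
  linarith

theorem hasMIP_of_eq_closedConvexHull_farthestPoints
    (h : ∀ K : Set X, K.Nonempty → IsClosed K → Bornology.IsBounded K → Convex ℝ K →
      K = closedConvexHull ℝ (farthestPoints K)) : HasMIP X := by
  intro K hne hcl hb hconv
  refine Subset.antisymm (subset_sInter fun B hB => hB.2) fun x₀ hx₀ => ?_
  by_contra hx₀K
  obtain ⟨f, u, hfK, hfx⟩ := geometric_hahn_banach_closed_point hconv hcl hx₀K
  obtain ⟨k₀, hk₀⟩ := hne
  have hne₀ : x₀ ≠ k₀ := fun he => hx₀K (he ▸ hk₀)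
  have : Nontrivial X := ⟨x₀, k₀, hne₀⟩
  -- `ε` is small enough for the enlargement to stay separated from `x₀`
  set ε := (f x₀ - u) / (‖f‖ + 1) / 2 with hε
  have hεpos : 0 < ε := by
    have : 0 < f x₀ - u := by linarith
    positivity
  have hεf : ‖f‖ * ε < f x₀ - u := by
    have h1 : (‖f‖ + 1) * (2 * ε) = f x₀ - u := by
      rw [hε]; field_simp
    nlinarith [norm_nonneg f]
  obtain ⟨x, hx⟩ := exists_norm_sub_le_of_closedConvexHull_farthestPoints
    (S := K + closedBall 0 ε) (x₀ := x₀) (hb.add isBounded_closedBall) f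
    (s := u + ‖f‖ * ε) (by
      rintro _ ⟨k, hk, e, he, rfl⟩
      have h1 : f e ≤ ‖f‖ * ‖e‖ := (le_abs_self _).trans (f.le_opNorm e)
      have h2 : ‖f‖ * ‖e‖ ≤ ‖f‖ * ε := by
        gcongr
        simpa using he
      have h3 := hfK k hk
      simp only [map_add]
      linarith) (by linarith)
    (h _ ⟨x₀, subset_closedConvexHull (mem_insert _ _)⟩ isClosed_closedConvexHull
      (by
        rw [closedConvexHull_eq_closure_convexHull]
        exact (isBounded_convexHull.2 ((hb.add isBounded_closedBall).insert x₀)).closure)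
      convex_closedConvexHull)
  have hKx : ∀ k ∈ K, ‖k - x‖ + ε ≤ ‖x₀ - x‖ := by
    intro k hk
    obtain ⟨e, he, hke⟩ := exists_norm_add_eq_add (k - x) hεpos.le
    have := hx (k + e) ⟨k, hk, e, by simpa using he, rfl⟩
    rwa [add_sub_right_comm, hke] at this
  have hx₀' := hx₀ (closedBall x (‖x₀ - x‖ - ε / 2))
    ⟨⟨x, _, by linarith [hKx k₀ hk₀, norm_nonneg (k₀ - x)], rfl⟩, fun k hk => by
      rw [mem_closedBall, dist_eq_norm]
      linarith [hKx k hk]⟩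
  rw [mem_closedBall, dist_eq_norm] at hx₀'
  linarith

end ToMIP

/-! ### From the Mazur intersection property to farthest points -/

section FromMIP

variable {X : Type*} [NormedAddCommGroup X] [NormedSpace ℝ X]

/-- Every decreasing sequence of nonempty closed bounded convex sets has a common point. For Banach
spaces this is Šmulian's characterization of reflexivity. -/
def HasNestedConvexIntersection (X : Type*) [NormedAddCommGroup X] [NormedSpace ℝ X] : Prop :=
  ∀ C : ℕ → Set X, Antitone C → (∀ n, (C n).Nonempty) → (∀ n, IsClosed (C n)) →
    (∀ n, Bornology.IsBounded (C n)) → (∀ n, Convex ℝ (C n)) → (⋂ n, C n).Nonempty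

/-- The Mazur property replaces each set of the sequence by the balls containing it, and the ball
intersection property applies to all these balls together. -/
theorem HasMIP.nonempty_iInter_of_antitone (hM : HasMIP X) (hIP : HasIPFinInf X) :
    HasNestedConvexIntersection X := by
  intro C hanti hne hcl hb hconv
  set 𝓑 : Set (Set X) := {B | IsClosedBall B ∧ ∃ n, C n ⊆ B} with h𝓑
  rcases (⋂₀ 𝓑).eq_empty_or_nonempty with hempty | ⟨p, hp⟩
  · obtain ⟨𝓕, h𝓕, hfin, h𝓕e⟩ := hIP 𝓑 (fun B hB => hB.1) hempty
    choose! n hn using fun B (hB : B ∈ 𝓕) => (h𝓕 hB).2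
    obtain ⟨N, hN⟩ := (hfin.image n).bddAbove
    obtain ⟨q, hq⟩ := hne N
    have : q ∈ ⋂₀ 𝓕 := fun B hB => hn B hB (hanti (hN (mem_image_of_mem n hB)) hq)
    simp [h𝓕e] at this
  · refine ⟨p, mem_iInter.2 fun n => ?_⟩
    rw [hM (C n) (hne n) (hcl n) (hb n) (hconv n)]
    exact fun B hB => hp B ⟨hB.1, n, hB.2⟩

/-- The points `x` lying within `δ` of some `y` such that `x` is nearly obtained by moving `y` away
from some `k ∈ K` by a multiple `t` of `y - k`, and the farthest distance nearly increases by the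
factor `1 + t`; all errors are at most `t * δ`. -/
def nearlyRadial (K : Set X) (δ : ℝ) : Set X :=
  {x | ∃ y, ∃ k ∈ K, ∃ t : ℝ, 0 < t ∧ ‖x - y‖ < δ ∧ ‖x - y - t • (y - k)‖ < t * δ ∧
    farthestDist K y + t * farthestDist K y - t * δ < farthestDist K x}

theorem isOpen_nearlyRadial {K : Set X} (hne : K.Nonempty) (hK : Bornology.IsBounded K) (δ : ℝ) :
    IsOpen (nearlyRadial K δ) := by
  have hc := continuous_farthestDist hne hK
  simp only [nearlyRadial, ofPred_exists, ofPred_and]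
  refine isOpen_iUnion fun y => isOpen_iUnion fun k => ?_
  refine isOpen_const.inter (isOpen_iUnion fun t => isOpen_const.inter ?_)
  exact (isOpen_lt (by fun_prop) continuous_const).inter
    ((isOpen_lt (by fun_prop) continuous_const).inter (isOpen_lt continuous_const hc))

theorem dense_nearlyRadial {K : Set X} (hne : K.Nonempty) (hK : Bornology.IsBounded K) {δ : ℝ}
    (hδ : 0 < δ) : Dense (nearlyRadial K δ) := by
  rw [Metric.dense_iff]
  intro y ρ hρ
  set r := farthestDist K y with hr
  have hr0 : 0 ≤ r := farthestDist_nonneg hne hK y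
  obtain ⟨t, ht0, ht1, htr⟩ : ∃ t : ℝ, 0 < t ∧ t ≤ 1 ∧ t * r < min ρ δ := by
    have hm : 0 < min ρ δ := lt_min hρ hδ
    refine ⟨min 1 (min ρ δ / (r + 1)), lt_min one_pos (by positivity), min_le_left _ _, ?_⟩
    calc min 1 (min ρ δ / (r + 1)) * r ≤ min ρ δ / (r + 1) * r := by
          gcongr
          exact min_le_right _ _
      _ < min ρ δ / (r + 1) * (r + 1) := by
          gcongr
          linarith
      _ = min ρ δ := div_mul_cancel₀ _ (by positivity)
  obtain ⟨k, hk, hky⟩ := exists_lt_norm_sub_of_lt_farthestDist hne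
    (show r - t * δ / 2 < farthestDist K y by linarith [mul_pos ht0 hδ])
  have hxy : ‖t • (y - k)‖ ≤ t * r := by
    rw [norm_smul, Real.norm_of_nonneg ht0.le, norm_sub_rev]
    gcongr
    exact norm_sub_le_farthestDist hK hk y
  refine ⟨y + t • (y - k), ?_, y, k, hk, t, ht0, ?_, ?_, ?_⟩
  · rw [mem_ball, dist_eq_norm, add_sub_cancel_left]
    exact hxy.trans_lt (htr.trans_le (min_le_left _ _))
  · rw [add_sub_cancel_left]
    exact hxy.trans_lt (htr.trans_le (min_le_right _ _))
  · simpa using mul_pos ht0 hδ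
  · have h1 : ‖k - (y + t • (y - k))‖ = (1 + t) * ‖k - y‖ := by
      have : k - (y + t • (y - k)) = (1 + t) • (k - y) := by module
      rw [this, norm_smul, Real.norm_of_nonneg (by positivity)]
    have h2 := norm_sub_le_farthestDist hK hk (y + t • (y - k))
    have h3 : (1 + t) * (r - t * δ / 2) < (1 + t) * ‖k - y‖ := by gcongr
    have h4 : t * (t * δ) ≤ 1 * (t * δ) := by gcongr
    nlinarith

/-- A subgradient of the farthest distance map at a nearly radial point nearly attains that
distance on `x - K`. -/
theorem exists_sub_lt_subgradient_of_mem_nearlyRadial {K : Set X} (hne : K.Nonempty)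
    (hK : Bornology.IsBounded K) {δ : ℝ} {x : X} (hx : x ∈ nearlyRadial K δ)
    {f : StrongDual ℝ X} (hf : ∀ y, farthestDist K x + f (y - x) ≤ farthestDist K y)
    (hfn : ∀ v, f v ≤ ‖v‖) : ∃ k ∈ K, farthestDist K x - 4 * δ < f (x - k) := by
  obtain ⟨y, k, hk, t, ht, hxy, hxyk, hr⟩ := hx
  refine ⟨k, hk, ?_⟩
  have h1 : farthestDist K x - farthestDist K y ≤ f (x - y) := by
    have := hf y
    rw [← neg_sub x y, map_neg] at this
    linarith
  have h2 : f (x - y) ≤ t * f (y - k) + t * δ := by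
    have := hfn (x - y - t • (y - k))
    rw [map_sub f (x - y), map_smul, smul_eq_mul] at this
    linarith
  have h3 : farthestDist K y - 2 * δ < f (y - k) := by
    refine lt_of_mul_lt_mul_left ?_ ht.le
    nlinarith
  have h4 : f (x - k) = f (y - k) - f (y - x) := by rw [← map_sub]; congr 1; abel
  have h5 := hfn (y - x)
  rw [norm_sub_rev] at h5
  have h6 := farthestDist_le_add_norm_sub hne hK x y
  linarith

theorem dense_setOf_farthestFrom_nonempty [CompleteSpace X] (hX : HasNestedConvexIntersection X)
    {K : Set X} (hne : K.Nonempty) (hcl : IsClosed K) (hb : Bornology.IsBounded K)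
    (hconv : Convex ℝ K) : Dense {x | (farthestFrom K x).Nonempty} := by
  have hpos : ∀ n : ℕ, (0 : ℝ) < 1 / (n + 1) := fun n => Nat.one_div_pos_of_nat
  refine (dense_iInter_of_isOpen_nat (fun n : ℕ => isOpen_nearlyRadial hne hb (1 / (n + 1)))
    (fun n => dense_nearlyRadial hne hb (hpos n))).mono fun x hx => ?_
  obtain ⟨f, hf⟩ := (convexOn_farthestDist hne hb).exists_subgradient
    (continuous_farthestDist hne hb) x
  have hfn : ∀ v, f v ≤ ‖v‖ := by
    intro v
    have h1 := hf (x + v)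
    have h2 := farthestDist_le_add_norm_sub hne hb (x + v) x
    rw [add_sub_cancel_left] at h1 h2
    linarith
  obtain ⟨k, hk⟩ := hX
    (fun n : ℕ => K ∩ {k | f k ≤ f x - farthestDist K x + 4 * (1 / (n + 1))})
    (fun m n hmn k hk => ⟨hk.1, le_trans hk.2 (by
      have := Nat.one_div_le_one_div (α := ℝ) hmn
      show f x - farthestDist K x + 4 * (1 / (n + 1 : ℝ)) ≤
        f x - farthestDist K x + 4 * (1 / (m + 1 : ℝ))
      linarith)⟩)
    (fun n => by
      obtain ⟨k, hk, hfk⟩ :=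
        exists_sub_lt_subgradient_of_mem_nearlyRadial hne hb (mem_iInter.1 hx n) hf hfn
      refine ⟨k, hk, ?_⟩
      rw [map_sub] at hfk
      simp only [mem_ofPred_eq]
      linarith)
    (fun n => hcl.inter (isClosed_le f.continuous continuous_const))
    (fun n => hb.subset inter_subset_left)
    (fun n => hconv.inter (convex_halfSpace_le f.isLinear _))
  have hk' := mem_iInter.1 hk
  have hkK : k ∈ K := (hk' 0).1
  have hlim : f k ≤ f x - farthestDist K x + 4 * 0 :=
    ge_of_tendsto' ((tendsto_one_div_add_atTop_nhds_zero_nat.const_mul 4).const_add _)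
      fun n => (hk' n).2
  refine ⟨k, hkK, le_antisymm (norm_sub_le_farthestDist hb hkK x) ?_⟩
  have := hfn (x - k)
  rw [map_sub, norm_sub_rev] at this
  linarith

theorem HasMIP.eq_closedConvexHull_farthestPoints (hM : HasMIP X) {K : Set X}
    (hcl : IsClosed K) (hb : Bornology.IsBounded K) (hconv : Convex ℝ K)
    (hdense : Dense {x | (farthestFrom K x).Nonempty}) :
    K = closedConvexHull ℝ (farthestPoints K) := by
  have hsub : closedConvexHull ℝ (farthestPoints K) ⊆ K :=
    closedConvexHull_min (fun z hz => (mem_farthestPoints_iff.1 hz).1) hconv hcl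
  refine Subset.antisymm (fun x₀ hx₀ => ?_) hsub
  obtain ⟨x, z, hz⟩ := hdense.nonempty
  rw [hM (closedConvexHull ℝ (farthestPoints K)) ⟨z, subset_closedConvexHull (mem_iUnion.2 ⟨x, hz⟩)⟩ isClosed_closedConvexHull
    (hb.subset hsub) convex_closedConvexHull]
  rintro _ ⟨⟨y, ρ, -, rfl⟩, hL⟩
  by_contra hx₀y
  rw [mem_closedBall, dist_eq_norm, not_le] at hx₀y
  obtain ⟨y', ⟨w, hwK, hw⟩, hy'⟩ := hdense.exists_dist_lt y
    (show 0 < (‖x₀ - y‖ - ρ) / 2 by linarith)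
  have h1 := hL (subset_closedConvexHull (mem_iUnion.2 ⟨y', hwK, hw⟩))
  rw [mem_closedBall, dist_eq_norm] at h1
  rw [dist_eq_norm] at hy'
  have h2 := norm_sub_le_farthestDist hb hx₀ y'
  have h3 := norm_sub_le_norm_sub_add_norm_sub w y y'
  have h4 := norm_sub_le_norm_sub_add_norm_sub x₀ y' y
  rw [norm_sub_rev y' y] at h4
  linarith

end FromMIP

theorem mainTheorem4 (X : Type*) [NormedAddCommGroup X] [NormedSpace ℝ X] [CompleteSpace X]
    (hIP : HasIPFinInf X) :
    HasMIP X ↔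
      ∀ K : Set X, K.Nonempty → IsClosed K → Bornology.IsBounded K → Convex ℝ K →
        K = closedConvexHull ℝ (farthestPoints K) :=
  ⟨fun hM _ hne hcl hb hconv => hM.eq_closedConvexHull_farthestPoints hcl hb hconv
    (dense_setOf_farthestFrom_nonempty (hM.nonempty_iInter_of_antitone hIP) hne hcl hb hconv),
    hasMIP_of_eq_closedConvexHull_farthestPoints⟩
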